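/- Let $\mathbb D$ be the open unit disk in $\mathbb C$. A weight is a bounded, continuous, strictly positive function $\mu:\mathbb D\to(0,\infty)$. The $\mu$-Bloch space $\mathcal B^\mu$ consists of all holomorphic $f:\mathbb D\to\mathbb C$ with $\|f\|_\mu:=\sup_{z\in\mathbb D}\mu(z)|f'(z)|<\infty$, with norm $\|f\|_{\mathcal B^\mu}:=|f(0)|+\|f\|_\mu$. For the weight $v_{\log}(z)=(1-|z|)\log\frac{3}{1-|z|}$ write $\mathcal B^{\log}:=\mathcal B^{v_{\log}}$ and $\|\cdot\|_{\log}:=\|\cdot\|_{v_{\log}}$. For a bounded linear operator $T:X\to Y$ between normed spaces, the essential norm is $\|T\|_e:=\inf\{\|T-K\| : K:X\to Y \text{ compact linear}\}$. Theorem. Let $\mu$ be a weight on $\mathbb D$ and let $\phi:\mathbb D\to\mathbb D$ be holomorphic such that the composition operator $C_\phi f=f\circ\phi$ is a bounded operator from $\mathcal B^{\log}$ to $\mathcal B^\mu$. Put $L=1-\frac{1}{\log 3}$ and $$E:=\limsup_{j\to\infty}\frac{\|\phi^j\|_\mu}{\|z^j\|_{\log}},$$ where $\phi^j$ is the $j$-th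 (pointwise) power of $\phi$ and $z^j$ denotes the function $z\mapsto z^j$. Then $E$ is finite and $$E\;\le\;\|C_\phi\|_e\;\le\;\frac{2L+6e^{L-1}}{L}\,E .$$ In particular $\|C_\phi\|_e$ and $E$ are comparable with constants that depend neither on $\phi$ nor on $\mu$. -/

import Mathlib

open Filter
open scoped Complex.UnitDisc

/-- A function on the open unit disc, extended by `0` to the complex plane. -/
noncomputable def discExt (f : 𝔻 → ℂ) (w : ℂ) : ℂ :=
  if h : ‖w‖ < 1 then f (Complex.UnitDisc.mk w h) else 0

/-- `f` is holomorphic on the open unit disc. -/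
def DiscHolomorphic (f : 𝔻 → ℂ) : Prop :=
  DifferentiableOn ℂ (discExt f) (Metric.ball 0 1)

/-- The complex derivative of a function on the open unit disc. The disc is open, so the extension
by `0` plays no role. -/
noncomputable def discDeriv (f : 𝔻 → ℂ) (z : 𝔻) : ℂ :=
  deriv (discExt f) (z : ℂ)

/-- A weight: a bounded, continuous and strictly positive function on the unit disc. -/
structure DiscWeight where
  /-- The underlying function. -/
  toFun : 𝔻 → ℝ
  continuous' : Continuous toFun
  pos' : ∀ z, 0 < toFun z
  bounded' : ∃ C, ∀ z, toFun z ≤ C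

instance : CoeFun DiscWeight (fun _ => 𝔻 → ℝ) := ⟨DiscWeight.toFun⟩

/-- The semi-norm `‖f‖_μ = sup_z μ(z) |f'(z)|` (used only for functions for which the supremum
is finite). -/
noncomputable def blochSeminorm (μ : DiscWeight) (f : 𝔻 → ℂ) : ℝ :=
  ⨆ z : 𝔻, μ z * ‖discDeriv f z‖

/-- Membership in the `μ`-Bloch space: `f` is holomorphic and `sup_z μ(z) |f'(z)| < ∞`. -/
def IsBloch (μ : DiscWeight) (f : 𝔻 → ℂ) : Prop :=
  DiscHolomorphic f ∧ BddAbove (Set.range fun z : 𝔻 => μ z * ‖discDeriv f z‖)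

theorem DiscHolomorphic.differentiableAt {f : 𝔻 → ℂ} (hf : DiscHolomorphic f) (z : 𝔻) :
    DifferentiableAt ℂ (discExt f) (z : ℂ) :=
  DifferentiableOn.differentiableAt hf
    (Metric.isOpen_ball.mem_nhds (mem_ball_zero_iff.2 z.norm_lt_one))

theorem discExt_coe (f : 𝔻 → ℂ) (z : 𝔻) : discExt f (z : ℂ) = f z := by
  simp [discExt, z.norm_lt_one]

theorem discExt_add (f g : 𝔻 → ℂ) : discExt (f + g) = discExt f + discExt g := by
  funext w
  by_cases h : ‖w‖ < 1 <;> simp [discExt, h]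

theorem discExt_smul (c : ℂ) (f : 𝔻 → ℂ) : discExt (c • f) = c • discExt f := by
  funext w
  by_cases h : ‖w‖ < 1 <;> simp [discExt, h]

theorem discExt_zero : discExt 0 = 0 := by
  funext w
  by_cases h : ‖w‖ < 1 <;> simp [discExt, h]

theorem discDeriv_add {f g : 𝔻 → ℂ} (hf : DiscHolomorphic f) (hg : DiscHolomorphic g) (z : 𝔻) :
    discDeriv (f + g) z = discDeriv f z + discDeriv g z := by
  rw [discDeriv, discExt_add]
  exact deriv_add (hf.differentiableAt z) (hg.differentiableAt z)

theorem discDeriv_smul (c : ℂ) (f : 𝔻 → ℂ) (z : 𝔻) :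
    discDeriv (c • f) z = c * discDeriv f z := by
  rw [discDeriv, discExt_smul, deriv_const_smul_field, smul_eq_mul, discDeriv]

/-- The `μ`-Bloch space as a linear subspace of the functions on the disc. -/
def blochSubmodule (μ : DiscWeight) : Submodule ℂ (𝔻 → ℂ) where
  carrier := {f | IsBloch μ f}
  zero_mem' := by
    refine ⟨?_, 0, ?_⟩
    · rw [DiscHolomorphic, discExt_zero]
      exact differentiableOn_const 0
    · rintro _ ⟨z, rfl⟩
      simp [discDeriv, discExt_zero]
  add_mem' := by
    rintro f g ⟨hf, A, hA⟩ ⟨hg, B, hB⟩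
    refine ⟨?_, A + B, ?_⟩
    · rw [DiscHolomorphic, discExt_add]
      exact DifferentiableOn.add hf hg
    · rintro _ ⟨z, rfl⟩
      have h1 := hA ⟨z, rfl⟩
      have h2 := hB ⟨z, rfl⟩
      have h3 := mul_le_mul_of_nonneg_left (norm_add_le (discDeriv f z) (discDeriv g z))
        (μ.pos' z).le
      simp only [discDeriv_add hf hg] at *
      linarith
  smul_mem' := by
    rintro c f ⟨hf, A, hA⟩
    refine ⟨?_, ‖c‖ * A, ?_⟩
    · rw [DiscHolomorphic, discExt_smul]
      exact DifferentiableOn.const_smul hf c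
    · rintro _ ⟨z, rfl⟩
      have h1 := mul_le_mul_of_nonneg_left (hA ⟨z, rfl⟩) (norm_nonneg c)
      simp only [discDeriv_smul, norm_mul] at *
      linarith

/-- The `μ`-Bloch space `𝓑^μ` of the unit disc, as a type of its own: its topology is the one of
the norm below, not the topology of pointwise convergence. -/
def BlochSpace (μ : DiscWeight) : Type := ↥(blochSubmodule μ)

namespace BlochSpace

variable {μ : DiscWeight}

noncomputable instance : AddCommGroup (BlochSpace μ) :=
  inferInstanceAs (AddCommGroup ↥(blochSubmodule μ))

noncomputable instance : Module ℂ (BlochSpace μ) :=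
  inferInstanceAs (Module ℂ ↥(blochSubmodule μ))

/-- The function underlying an element of the `μ`-Bloch space. -/
def toFun (f : BlochSpace μ) : 𝔻 → ℂ := f.1

theorem isBloch (f : BlochSpace μ) : IsBloch μ f.toFun := f.2

/-- A function with the Bloch property, as an element of the `μ`-Bloch space. -/
def mk (f : 𝔻 → ℂ) (hf : IsBloch μ f) : BlochSpace μ := ⟨f, hf⟩

/-- The norm `‖f‖_{𝓑^μ} = |f(0)| + ‖f‖_μ`. -/
noncomputable instance : Norm (BlochSpace μ) :=
  ⟨fun f => ‖f.toFun 0‖ + blochSeminorm μ f.toFun⟩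

theorem norm_def (f : BlochSpace μ) : ‖f‖ = ‖f.toFun 0‖ + blochSeminorm μ f.toFun := rfl

theorem le_seminorm (f : BlochSpace μ) (z : 𝔻) :
    μ z * ‖discDeriv f.toFun z‖ ≤ blochSeminorm μ f.toFun :=
  le_ciSup f.isBloch.2 z

theorem seminorm_nonneg (f : 𝔻 → ℂ) : 0 ≤ blochSeminorm μ f :=
  Real.iSup_nonneg fun z => mul_nonneg (μ.pos' z).le (norm_nonneg _)

theorem core (μ : DiscWeight) : NormedSpace.Core ℂ (BlochSpace μ) where
  norm_nonneg f := add_nonneg (norm_nonneg _) (seminorm_nonneg _)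
  norm_smul c f := by
    have h : ∀ z, discDeriv (c • f).toFun z = c * discDeriv f.toFun z :=
      discDeriv_smul c f.toFun
    have h0 : (c • f).toFun 0 = c * f.toFun 0 := rfl
    rw [norm_def, norm_def, h0, norm_mul, mul_add, blochSeminorm, blochSeminorm,
      Real.mul_iSup_of_nonneg (norm_nonneg c)]
    congr 2
    funext z
    rw [h, norm_mul]
    ring
  norm_triangle f g := by
    have h : ∀ z, discDeriv (f + g).toFun z = discDeriv f.toFun z + discDeriv g.toFun z :=
      discDeriv_add f.isBloch.1 g.isBloch.1
    have h0 : (f + g).toFun 0 = f.toFun 0 + g.toFun 0 := rfl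
    have h1 : blochSeminorm μ (f + g).toFun ≤
        blochSeminorm μ f.toFun + blochSeminorm μ g.toFun := by
      refine ciSup_le fun z => ?_
      have h2 := mul_le_mul_of_nonneg_left
        (norm_add_le (discDeriv f.toFun z) (discDeriv g.toFun z)) (μ.pos' z).le
      have h3 := f.le_seminorm z
      have h4 := g.le_seminorm z
      rw [h]
      linarith
    have h5 := norm_add_le (f.toFun 0) (g.toFun 0)
    rw [norm_def, norm_def, norm_def, h0]
    linarith
  norm_eq_zero_iff f := by
    constructor
    · intro h
      have hs := seminorm_nonneg (μ := μ) f.toFun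
      have hn := norm_nonneg (f.toFun 0)
      rw [norm_def] at h
      have hd : ∀ z, discDeriv f.toFun z = 0 := by
        intro z
        have h1 := f.le_seminorm z
        have h2 : ‖discDeriv f.toFun z‖ ≤ 0 := by
          by_contra h3
          have := mul_pos (μ.pos' z) (not_le.1 h3)
          linarith
        exact norm_le_zero_iff.1 h2
      have h0 : f.toFun 0 = 0 := norm_le_zero_iff.1 (by linarith)
      have hE : Set.EqOn (deriv (discExt f.toFun)) 0 (Metric.ball 0 1) := by
        intro w hw
        exact hd (Complex.UnitDisc.mk w (mem_ball_zero_iff.1 hw))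
      apply Subtype.ext
      funext z
      have h1 := Metric.isOpen_ball.is_const_of_deriv_eq_zero
        (convex_ball (0 : ℂ) 1).isPreconnected f.isBloch.1 hE
        (mem_ball_zero_iff.2 z.norm_lt_one) (mem_ball_zero_iff.2 (0 : 𝔻).norm_lt_one)
      rw [discExt_coe, discExt_coe, h0] at h1
      exact h1
    · rintro rfl
      have h0 : (0 : BlochSpace μ).toFun = 0 := rfl
      rw [norm_def, h0]
      simp [blochSeminorm, discDeriv, discExt_zero]

noncomputable instance : NormedAddCommGroup (BlochSpace μ) := NormedAddCommGroup.ofCore (core μ)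

noncomputable instance : NormedSpace ℂ (BlochSpace μ) := NormedSpace.ofCore (core μ)

end BlochSpace

/-- The logarithmic weight `v_log(z) = (1 - |z|) log (3 / (1 - |z|))`. -/
noncomputable def logWeight : DiscWeight where
  toFun z := (1 - ‖(z : ℂ)‖) * Real.log (3 / (1 - ‖(z : ℂ)‖))
  continuous' := by
    have h : Continuous fun z : 𝔻 => 1 - ‖(z : ℂ)‖ :=
      continuous_const.sub Complex.UnitDisc.continuous_coe.norm
    have hp : ∀ z : 𝔻, 1 - ‖(z : ℂ)‖ ≠ 0 := fun z => (sub_pos.2 z.norm_lt_one).ne'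
    exact h.mul ((continuous_const.div h hp).log fun z => div_ne_zero (by norm_num) (hp z))
  pos' z := by
    have h := sub_pos.2 z.norm_lt_one
    refine mul_pos h (Real.log_pos ?_)
    rw [lt_div_iff₀ h]
    linarith [norm_nonneg (z : ℂ)]
  bounded' := by
    refine ⟨3, fun z => ?_⟩
    have h := sub_pos.2 z.norm_lt_one
    calc (1 - ‖(z : ℂ)‖) * Real.log (3 / (1 - ‖(z : ℂ)‖))
        ≤ (1 - ‖(z : ℂ)‖) * (3 / (1 - ‖(z : ℂ)‖)) :=
          mul_le_mul_of_nonneg_left (Real.log_le_self (by positivity)) h.le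
      _ = 3 := by field_simp

/-- The composition operator `C_φ f = f ∘ φ`, as a linear map `𝓑^ν → 𝓑^μ`, for a self-map `φ` of
the disc that maps `𝓑^ν` into `𝓑^μ`. -/
noncomputable def compOperator {ν μ : DiscWeight} (φ : 𝔻 → 𝔻)
    (h : ∀ f : 𝔻 → ℂ, IsBloch ν f → IsBloch μ (f ∘ φ)) : BlochSpace ν →ₗ[ℂ] BlochSpace μ where
  toFun f := BlochSpace.mk (f.toFun ∘ φ) (h f.toFun f.isBloch)
  map_add' _ _ := rfl
  map_smul' _ _ := rfl

/-- The essential norm of a bounded operator: its distance, in the operator norm, from the set of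
compact operators. -/
noncomputable def essentialNorm {X Y : Type*} [NormedAddCommGroup X] [NormedSpace ℂ X]
    [NormedAddCommGroup Y] [NormedSpace ℂ Y] (T : X →L[ℂ] Y) : ℝ :=
  sInf {r : ℝ | ∃ K : X →L[ℂ] Y, IsCompactOperator K ∧ r = ‖T - K‖}

/-- The quotient `‖φ^j‖_μ / ‖z^j‖_log`. -/
noncomputable def powerRatio (μ : DiscWeight) (φ : 𝔻 → 𝔻) (j : ℕ) : ℝ :=
  blochSeminorm μ (fun z => (φ z : ℂ) ^ j) / blochSeminorm logWeight (fun z => (z : ℂ) ^ j)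

/-- The constant `L = 1 - 1 / log 3`. -/
noncomputable def logConst : ℝ := 1 - 1 / Real.log 3

/-!
Lower bound: for a weight `ν` vanishing at the unit circle, the normalized monomials behave like the
unit vectors of `c₀`: a sum of arbitrarily many of them, chosen sparse enough, has norm about `1`.
Hence every compact operator sends them to `0`, and the images under `C_φ` of the monomials bound
its essential norm from below.

Upper bound: subtract from `C_φ` its composition with a finite rank operator that maps `f` to a
Taylor polynomial of the dilation `f (r ·)`. What remains of `f` is negligible on `|z| ≤ s` and has
norm at most about `2 ‖f‖`, so only the points with `|φ z| > s` count, and the essential norm is at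
most twice the upper limit of `μ |φ'| / ν (φ)` as `|φ| → 1`. Testing on `φ ^ j` with `j` about
`1 / (2 (1 - |φ z|))` shows that this upper limit is at most `4 E` for the logarithmic weight.
Altogether the constant is `8`, and `8 ≤ (2 L + 6 exp (L - 1)) / L` because `L ≤ exp (L - 1)`.
-/

/-- A sequence in a normed space is almost disjoint if adding a far-out term to a finite sum of its
terms does not increase the norm essentially, once that norm is at least `1`. This is the property
of the unit vectors of `c₀` that compact operators notice. -/
def AlmostDisjoint {X : Type*} [NormedAddCommGroup X] (u : ℕ → X) : Prop :=
  ∀ F : Finset ℕ, ∀ δ > 0, ∀ᶠ n in atTop, ‖∑ i ∈ F, u i + u n‖ ≤ max ‖∑ i ∈ F, u i‖ 1 + δ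

namespace AlmostDisjoint

variable {𝕜 X Y : Type*} [NormedAddCommGroup X] {u : ℕ → X}

theorem exists_finset_norm_sum_le (hu : AlmostDisjoint u) {p : ℕ → Prop}
    (hp : ∃ᶠ n in atTop, p n) {δ : ℝ} (hδ : 0 < δ) (N : ℕ) :
    ∃ F : Finset ℕ, F.card = N ∧ (∀ n ∈ F, p n) ∧ ‖∑ n ∈ F, u n‖ ≤ 1 + N * δ := by
  induction N with
  | zero => exact ⟨∅, by simp⟩
  | succ N ih =>
    obtain ⟨F, hcard, hpF, hnorm⟩ := ih
    have hfar : ∀ᶠ n in atTop, n ∉ F :=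
      Nat.cofinite_eq_atTop ▸ F.finite_toSet.eventually_cofinite_notMem
    obtain ⟨n, hpn, hn, hnF⟩ := (hp.and_eventually ((hu F δ hδ).and hfar)).exists
    have hmax : max ‖∑ i ∈ F, u i‖ 1 ≤ 1 + N * δ :=
      max_le hnorm (le_add_of_nonneg_right (by positivity))
    refine ⟨insert n F, by simp [hnF, hcard], by simpa [hpn] using hpF, ?_⟩
    rw [Finset.sum_insert hnF, add_comm (u n)]
    push_cast
    linarith

variable [RCLike 𝕜] [NormedSpace 𝕜 X] [NormedAddCommGroup Y] [NormedSpace 𝕜 Y]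

-- If `K (u n)` is close to `y` for `N` almost disjoint terms, then the image of their sum is close
-- to `N • y`, although the sum has norm about `1`.
theorem eq_zero_of_mapClusterPt (hu : AlmostDisjoint u) (K : X →L[𝕜] Y) {y : Y}
    (hy : MapClusterPt y atTop fun n => K (u n)) : y = 0 := by
  have hbound (n : ℕ) : ‖y‖ ≤ (2 * ‖K‖ + 1) * (1 / (n + 1)) := by
    set ε : ℝ := 1 / (n + 1) with hε
    have hε0 : 0 < ε := by positivity
    have hεn : ((n + 1 : ℕ) : ℝ) * ε = 1 := by push_cast; rw [hε]; field_simp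
    obtain ⟨F, hcard, hclose, hnorm⟩ := hu.exists_finset_norm_sum_le
      (hy.frequently (Metric.closedBall_mem_nhds y hε0)) hε0 (n + 1)
    have hdist : ‖∑ i ∈ F, (y - K (u i))‖ ≤ 1 := by
      rw [← hεn, ← hcard, ← nsmul_eq_mul]
      refine (norm_sum_le_of_le F fun i hi => ?_).trans_eq (Finset.sum_const ε)
      simpa [dist_eq_norm, norm_sub_rev] using hclose i hi
    have hsum : (n + 1) • y = K (∑ i ∈ F, u i) + ∑ i ∈ F, (y - K (u i)) := by
      rw [Finset.sum_sub_distrib, Finset.sum_const, hcard, map_sum]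
      abel
    have hy' : (n + 1 : ℕ) * ‖y‖ ≤ 2 * ‖K‖ + 1 := by
      rw [← nsmul_eq_mul, ← RCLike.norm_nsmul 𝕜, hsum]
      have hKF : ‖K (∑ i ∈ F, u i)‖ ≤ ‖K‖ * 2 :=
        K.le_opNorm_of_le (hnorm.trans_eq (by rw [hεn]; norm_num))
      linarith [norm_add_le (K (∑ i ∈ F, u i)) (∑ i ∈ F, (y - K (u i)))]
    rw [mul_one_div, le_div_iff₀ (by positivity), mul_comm]
    exact_mod_cast hy'
  have hlim := tendsto_one_div_add_atTop_nhds_zero_nat (𝕜 := ℝ) |>.const_mul (2 * ‖K‖ + 1)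
  rw [mul_zero] at hlim
  exact norm_le_zero_iff.1 (ge_of_tendsto' hlim hbound)

theorem tendsto_zero_of_isCompactOperator (hu : AlmostDisjoint u) (hu1 : ∀ n, ‖u n‖ ≤ 1)
    {K : X →L[𝕜] Y} (hK : IsCompactOperator K) : Tendsto (fun n => K (u n)) atTop (nhds 0) :=
  (hK.isCompact_closure_image_closedBall
    (f := (K : X →ₗ[𝕜] Y)) 1).tendsto_nhds_of_unique_mapClusterPt
    (.of_forall fun n => subset_closure ⟨u n, by simpa using hu1 n, rfl⟩)
    fun _ _ hy => hu.eq_zero_of_mapClusterPt K hy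

end AlmostDisjoint

section EssentialNorm

variable {X Y : Type*} [NormedAddCommGroup X] [NormedSpace ℂ X]
  [NormedAddCommGroup Y] [NormedSpace ℂ Y]

theorem essentialNorm_le_norm_sub (T : X →L[ℂ] Y) {K : X →L[ℂ] Y} (hK : IsCompactOperator K) :
    essentialNorm T ≤ ‖T - K‖ :=
  csInf_le ⟨0, by rintro _ ⟨K, -, rfl⟩; exact norm_nonneg _⟩ ⟨K, hK, rfl⟩

theorem AlmostDisjoint.limsup_norm_apply_le_essentialNorm {u : ℕ → X} (hu : AlmostDisjoint u)
    (hu1 : ∀ n, ‖u n‖ ≤ 1) (T : X →L[ℂ] Y) :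
    limsup (fun n => ‖T (u n)‖) atTop ≤ essentialNorm T := by
  refine le_csInf ⟨_, 0, isCompactOperator_zero, rfl⟩ ?_
  rintro _ ⟨K, hK, rfl⟩
  have hle (n : ℕ) : ‖T (u n)‖ ≤ ‖T - K‖ + ‖K (u n)‖ := by
    calc ‖T (u n)‖ = ‖(T - K) (u n) + K (u n)‖ := by simp
      _ ≤ ‖(T - K) (u n)‖ + ‖K (u n)‖ := norm_add_le _ _
      _ ≤ ‖T - K‖ + ‖K (u n)‖ := by gcongr; exact (T - K).unit_le_opNorm _ (hu1 n)
  have hlim : Tendsto (fun n => ‖T - K‖ + ‖K (u n)‖) atTop (nhds ‖T - K‖) := by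
    simpa using (hu.tendsto_zero_of_isCompactOperator hu1 hK).norm.const_add ‖T - K‖
  calc limsup (fun n => ‖T (u n)‖) atTop
      ≤ limsup (fun n => ‖T - K‖ + ‖K (u n)‖) atTop :=
        limsup_le_limsup (.of_forall hle)
          (isCoboundedUnder_le_of_le atTop fun n => norm_nonneg _) hlim.isBoundedUnder_le
    _ = ‖T - K‖ := hlim.limsup_eq

theorem isCompactOperator_smulRight (l : X →L[ℂ] ℂ) (y : Y) :
    IsCompactOperator (l.smulRight y) :=
  (isCompactOperator_of_locallyCompactSpace_dom l).clm_comp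
    (ContinuousLinearMap.toSpanSingleton ℂ y)

theorem isCompactOperator_sum {ι : Type*} (s : Finset ι) {K : ι → X →L[ℂ] Y}
    (hK : ∀ i ∈ s, IsCompactOperator (K i)) : IsCompactOperator (∑ i ∈ s, K i : X →L[ℂ] Y) :=
  Finset.sum_induction K (fun K => IsCompactOperator K) (fun _ _ => IsCompactOperator.add)
    isCompactOperator_zero hK

end EssentialNorm

theorem discExt_eqOn_ball (F : ℂ → ℂ) :
    Set.EqOn (discExt fun z => F z) F (Metric.ball 0 1) := fun w hw => by
  simp [discExt, mem_ball_zero_iff.1 hw]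

theorem discHolomorphic_coe_iff {F : ℂ → ℂ} :
    (DiscHolomorphic fun z => F z) ↔ DifferentiableOn ℂ F (Metric.ball 0 1) :=
  differentiableOn_congr (discExt_eqOn_ball F)

theorem discDeriv_coe (F : ℂ → ℂ) (z : 𝔻) : discDeriv (fun z => F z) z = deriv F z :=
  ((discExt_eqOn_ball F).eventuallyEq_of_mem
    (Metric.isOpen_ball.mem_nhds (mem_ball_zero_iff.2 z.norm_lt_one))).deriv_eq

theorem discDeriv_comp {f : 𝔻 → ℂ} {φ : 𝔻 → 𝔻} (hf : DiscHolomorphic f)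
    (hφ : DiscHolomorphic fun z => (φ z : ℂ)) (z : 𝔻) :
    discDeriv (f ∘ φ) z = discDeriv f (φ z) * discDeriv (fun z => (φ z : ℂ)) z := by
  have hcomp : f ∘ φ = fun w : 𝔻 => (discExt f ∘ discExt fun z => (φ z : ℂ)) w := by
    funext w
    simp [discExt_coe]
  rw [hcomp, discDeriv_coe]
  refine (deriv_comp (z : ℂ) ?_ (hφ.differentiableAt z)).trans ?_
  · rw [discExt_coe]
    exact hf.differentiableAt (φ z)
  · rw [discExt_coe, discDeriv, discDeriv]

theorem discDeriv_pow (j : ℕ) (z : 𝔻) :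
    discDeriv (fun z : 𝔻 => (z : ℂ) ^ j) z = j * (z : ℂ) ^ (j - 1) := by
  rw [discDeriv_coe fun w => w ^ j, deriv_pow_field]

theorem norm_discDeriv_pow_succ (n : ℕ) (z : 𝔻) :
    ‖discDeriv (fun z : 𝔻 => (z : ℂ) ^ (n + 1)) z‖ = (n + 1) * ‖(z : ℂ)‖ ^ n := by
  rw [discDeriv_pow, norm_mul, norm_pow, Complex.norm_natCast, Nat.add_sub_cancel, Nat.cast_succ]

namespace DiscWeight

/-- The weight tends to `0` at the unit circle. -/
def VanishesAtBoundary (ν : DiscWeight) : Prop :=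
  ∀ ε > 0, ∃ ρ ∈ Set.Ico (0 : ℝ) 1, ∀ z : 𝔻, ρ < ‖(z : ℂ)‖ → ν z ≤ ε

/-- The weight is a decreasing function of the modulus. -/
def IsRadiallyDecreasing (ν : DiscWeight) : Prop :=
  ∀ ⦃w z : 𝔻⦄, ‖(w : ℂ)‖ ≤ ‖(z : ℂ)‖ → ν z ≤ ν w

theorem exists_pos_bound (ν : DiscWeight) : ∃ B > 0, ∀ z, ν z ≤ B :=
  let ⟨B, hB⟩ := ν.bounded'
  ⟨B, (ν.pos' 0).trans_le (hB 0), hB⟩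

theorem exists_pos_le_of_norm_le (ν : DiscWeight) {s : ℝ} (hs : s < 1) :
    ∃ c > 0, ∀ z : 𝔻, ‖(z : ℂ)‖ ≤ s → c ≤ ν z := by
  have hcompact : IsCompact {z : 𝔻 | ‖(z : ℂ)‖ ≤ s} := by
    have hrange : Metric.closedBall (0 : ℂ) s ⊆ Set.range ((↑) : 𝔻 → ℂ) := fun w hw =>
      ⟨.mk w ((mem_closedBall_zero_iff.1 hw).trans_lt hs), rfl⟩
    convert Complex.UnitDisc.isEmbedding_coe.isInducing.isCompact_preimage'
      (isCompact_closedBall (0 : ℂ) s) hrange using 1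
    ext z
    simp
  exact hcompact.exists_forall_le' ν.continuous'.continuousOn fun z _ => ν.pos' z

end DiscWeight

namespace BlochSpace

variable {ν : DiscWeight}

theorem norm_le_of_forall_le {f : BlochSpace ν} {C : ℝ} (h0 : f.toFun 0 = 0)
    (h : ∀ z, ν z * ‖discDeriv f.toFun z‖ ≤ C) : ‖f‖ ≤ C := by
  rw [norm_def, h0, norm_zero, zero_add]
  exact ciSup_le h

theorem blochSeminorm_le_norm (f : BlochSpace ν) : blochSeminorm ν f.toFun ≤ ‖f‖ :=
  le_add_of_nonneg_left (norm_nonneg _)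

theorem mul_norm_discDeriv_le_norm (f : BlochSpace ν) (z : 𝔻) :
    ν z * ‖discDeriv f.toFun z‖ ≤ ‖f‖ :=
  (f.le_seminorm z).trans f.blochSeminorm_le_norm

/-- Evaluation at the origin, as a bounded functional. -/
noncomputable def evalZero (ν : DiscWeight) : BlochSpace ν →L[ℂ] ℂ :=
  LinearMap.mkContinuous
    { toFun := fun f => f.toFun 0, map_add' := fun _ _ => rfl, map_smul' := fun _ _ => rfl } 1
    fun f => by
      rw [one_mul, norm_def]
      exact le_add_of_nonneg_right (seminorm_nonneg _)

/-- Evaluation of the derivative at a point, as a bounded functional. -/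
noncomputable def derivAt (ν : DiscWeight) (z : 𝔻) : BlochSpace ν →L[ℂ] ℂ :=
  LinearMap.mkContinuous
    { toFun := fun f => discDeriv f.toFun z
      map_add' := fun f g => discDeriv_add f.isBloch.1 g.isBloch.1 z
      map_smul' := fun c f => discDeriv_smul c f.toFun z } (ν z)⁻¹
    fun f => by
      rw [inv_mul_eq_div, le_div_iff₀' (ν.pos' z)]
      exact f.mul_norm_discDeriv_le_norm z

theorem evalZero_apply (f : BlochSpace ν) : evalZero ν f = f.toFun 0 := rfl

theorem derivAt_apply (f : BlochSpace ν) (z : 𝔻) : derivAt ν z f = discDeriv f.toFun z := rfl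

theorem exists_norm_deriv_discExt_le (ν : DiscWeight) {s : ℝ} (hs : s < 1) :
    ∃ C, ∀ (f : BlochSpace ν) (w : ℂ), ‖w‖ ≤ s → ‖deriv (discExt f.toFun) w‖ ≤ C * ‖f‖ := by
  obtain ⟨c, hc, hcν⟩ := ν.exists_pos_le_of_norm_le hs
  refine ⟨c⁻¹, fun f w hw => ?_⟩
  let z : 𝔻 := .mk w (hw.trans_lt hs)
  rw [inv_mul_eq_div, le_div_iff₀' hc]
  exact (mul_le_mul_of_nonneg_right (hcν z hw) (norm_nonneg _)).trans
    (f.mul_norm_discDeriv_le_norm z)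

theorem isBloch_pow (ν : DiscWeight) (j : ℕ) : IsBloch ν fun z : 𝔻 => (z : ℂ) ^ j := by
  obtain ⟨B, hB0, hB⟩ := ν.exists_pos_bound
  refine ⟨discHolomorphic_coe_iff.2 (differentiable_pow j).differentiableOn, B * j, ?_⟩
  rintro _ ⟨z, rfl⟩
  have hderiv : ‖discDeriv (fun z : 𝔻 => (z : ℂ) ^ j) z‖ ≤ j := by
    rw [discDeriv_pow, norm_mul, norm_pow, Complex.norm_natCast]
    exact mul_le_of_le_one_right j.cast_nonneg (pow_le_one₀ (norm_nonneg _) z.norm_lt_one.le)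
  exact mul_le_mul (hB z) hderiv (norm_nonneg _) hB0.le

/-- The monomial `z ↦ z ^ j` as an element of the Bloch space. -/
noncomputable def monomial (ν : DiscWeight) (j : ℕ) : BlochSpace ν := mk _ (isBloch_pow ν j)

theorem monomial_succ_toFun_zero (n : ℕ) : (monomial ν (n + 1)).toFun 0 = 0 :=
  zero_pow n.succ_ne_zero

theorem norm_monomial_succ (n : ℕ) :
    ‖monomial ν (n + 1)‖ = blochSeminorm ν fun z : 𝔻 => (z : ℂ) ^ (n + 1) := by
  rw [norm_def, monomial_succ_toFun_zero, norm_zero, zero_add]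
  rfl

theorem exists_le_blochSeminorm_pow (ν : DiscWeight) {s : ℝ} (hs0 : 0 ≤ s) (hs1 : s < 1) :
    ∃ c > 0, ∀ n : ℕ, c * ((n + 1) * s ^ n) ≤ blochSeminorm ν fun z : 𝔻 => (z : ℂ) ^ (n + 1) := by
  have hnorm : ‖(s : ℂ)‖ = s := by rw [Complex.norm_real, Real.norm_of_nonneg hs0]
  let z : 𝔻 := .mk s (hnorm.trans_lt hs1)
  refine ⟨ν z, ν.pos' z, fun n => ?_⟩
  have hz : ‖(z : ℂ)‖ = s := hnorm
  rw [← hz, ← norm_discDeriv_pow_succ n z]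
  exact (monomial ν (n + 1)).le_seminorm z

theorem blochSeminorm_pow_succ_pos (ν : DiscWeight) (n : ℕ) :
    0 < blochSeminorm ν fun z : 𝔻 => (z : ℂ) ^ (n + 1) := by
  obtain ⟨c, hc, h⟩ := exists_le_blochSeminorm_pow ν (s := 1 / 2) (by norm_num) (by norm_num)
  exact lt_of_lt_of_le (by positivity) (h n)

/-- The monomial `z ↦ z ^ (n + 1)`, normalized; the exponent is shifted because constants have
seminorm `0`. -/
noncomputable def unitMonomial (ν : DiscWeight) (n : ℕ) : BlochSpace ν :=
  ((‖monomial ν (n + 1)‖⁻¹ : ℝ) : ℂ) • monomial ν (n + 1)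

theorem norm_unitMonomial_le (n : ℕ) : ‖unitMonomial ν n‖ ≤ 1 := by
  rw [unitMonomial, norm_smul, Complex.norm_real, norm_inv, norm_norm]
  exact inv_mul_le_one

theorem unitMonomial_toFun_zero (n : ℕ) : (unitMonomial ν n).toFun 0 = 0 := by
  rw [← evalZero_apply, unitMonomial, map_smul, evalZero_apply, monomial_succ_toFun_zero, smul_zero]

theorem norm_discDeriv_unitMonomial (n : ℕ) (z : 𝔻) :
    ‖discDeriv (unitMonomial ν n).toFun z‖ =
      (n + 1) * ‖(z : ℂ)‖ ^ n / blochSeminorm ν fun z : 𝔻 => (z : ℂ) ^ (n + 1) := by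
  rw [← derivAt_apply, unitMonomial, map_smul, norm_smul, Complex.norm_real, norm_inv, norm_norm,
    norm_monomial_succ, inv_mul_eq_div, derivAt_apply, ← norm_discDeriv_pow_succ]
  rfl

theorem eventually_norm_discDeriv_unitMonomial_le {ρ ε : ℝ} (hρ0 : 0 ≤ ρ) (hρ1 : ρ < 1)
    (hε : 0 < ε) :
    ∀ᶠ n in atTop, ∀ z : 𝔻, ‖(z : ℂ)‖ ≤ ρ → ‖discDeriv (unitMonomial ν n).toFun z‖ ≤ ε := by
  obtain ⟨s, hρs, hs1⟩ := exists_between hρ1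
  have hs0 : 0 < s := hρ0.trans_lt hρs
  obtain ⟨c, hc, hcn⟩ := exists_le_blochSeminorm_pow ν hs0.le hs1
  have hlim := (tendsto_pow_atTop_nhds_zero_of_lt_one (div_nonneg hρ0 hs0.le)
    ((div_lt_one hs0).2 hρs)).eventually_lt_const (mul_pos hc hε)
  filter_upwards [hlim] with n hn z hz
  rw [norm_discDeriv_unitMonomial, div_le_iff₀ (blochSeminorm_pow_succ_pos ν n)]
  rw [div_pow, div_lt_iff₀ (pow_pos hs0 n)] at hn
  calc (n + 1) * ‖(z : ℂ)‖ ^ n ≤ (n + 1) * ρ ^ n := by gcongr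
    _ ≤ (n + 1) * (c * ε * s ^ n) := by gcongr
    _ = ε * (c * ((n + 1) * s ^ n)) := by ring
    _ ≤ ε * blochSeminorm ν fun z : 𝔻 => (z : ℂ) ^ (n + 1) := by gcongr; exact hcn n

-- Close to the unit circle the finite sum is invisible because the weight is small there, and on
-- the rest of the disc the far-out term is.
theorem almostDisjoint_of_vanishesAtBoundary {u : ℕ → BlochSpace ν} (hν : ν.VanishesAtBoundary)
    (h0 : ∀ n, (u n).toFun 0 = 0) (h1 : ∀ n, ‖u n‖ ≤ 1)
    (hbdd : ∀ n, ∃ M, ∀ z, ‖discDeriv (u n).toFun z‖ ≤ M)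
    (hlim : ∀ ρ ∈ Set.Ico (0 : ℝ) 1, ∀ ε > 0,
      ∀ᶠ n in atTop, ∀ z : 𝔻, ‖(z : ℂ)‖ ≤ ρ → ‖discDeriv (u n).toFun z‖ ≤ ε) :
    AlmostDisjoint u := by
  intro F δ hδ
  choose M hM using hbdd
  obtain ⟨B, hB0, hB⟩ := ν.exists_pos_bound
  have hsum (z : 𝔻) : ‖derivAt ν z (∑ i ∈ F, u i)‖ ≤ ∑ i ∈ F, M i := by
    rw [map_sum]
    exact norm_sum_le_of_le F fun i _ => hM i z
  have hM0 : 0 ≤ ∑ i ∈ F, M i := (norm_nonneg _).trans (hsum 0)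
  obtain ⟨ρ, hρ, hνρ⟩ := hν (δ / (∑ i ∈ F, M i + 1)) (by positivity)
  filter_upwards [hlim ρ hρ (δ / B) (by positivity)] with n hn
  refine norm_le_of_forall_le ?_ fun z => ?_
  · rw [← evalZero_apply, map_add, map_sum, evalZero_apply, h0, add_zero]
    exact Finset.sum_eq_zero fun i _ => h0 i
  have hSz := mul_norm_discDeriv_le_norm (∑ i ∈ F, u i) z
  have huz := mul_norm_discDeriv_le_norm (u n) z
  rw [← derivAt_apply] at hSz huz ⊢
  calc ν z * ‖derivAt ν z (∑ i ∈ F, u i + u n)‖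
      ≤ ν z * ‖derivAt ν z (∑ i ∈ F, u i)‖ + ν z * ‖derivAt ν z (u n)‖ := by
        rw [map_add, ← mul_add]
        exact mul_le_mul_of_nonneg_left (norm_add_le _ _) (ν.pos' z).le
    _ ≤ max ‖∑ i ∈ F, u i‖ 1 + δ := ?_
  rcases lt_or_ge ρ ‖(z : ℂ)‖ with hz | hz
  · have hS : ν z * ‖derivAt ν z (∑ i ∈ F, u i)‖ ≤ δ :=
      calc _ ≤ δ / (∑ i ∈ F, M i + 1) * (∑ i ∈ F, M i + 1) :=
            mul_le_mul (hνρ z hz) ((hsum z).trans (by linarith)) (norm_nonneg _) (by positivity)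
        _ = δ := by field_simp
    linarith [h1 n, le_max_right ‖∑ i ∈ F, u i‖ 1]
  · have hu : ν z * ‖derivAt ν z (u n)‖ ≤ δ :=
      calc _ ≤ B * (δ / B) := mul_le_mul (hB z) (hn z hz) (norm_nonneg _) hB0.le
        _ = δ := by field_simp
    linarith [le_max_left ‖∑ i ∈ F, u i‖ 1]

theorem almostDisjoint_unitMonomial (hν : ν.VanishesAtBoundary) :
    AlmostDisjoint (unitMonomial ν) := by
  refine almostDisjoint_of_vanishesAtBoundary hν unitMonomial_toFun_zero norm_unitMonomial_le
    (fun n => ⟨(n + 1) / blochSeminorm ν fun z : 𝔻 => (z : ℂ) ^ (n + 1), fun z => ?_⟩)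
    fun ρ hρ ε hε => eventually_norm_discDeriv_unitMonomial_le hρ.1 hρ.2 hε
  rw [norm_discDeriv_unitMonomial]
  have := blochSeminorm_pow_succ_pos ν n
  gcongr
  exact mul_le_of_le_one_right (by positivity) (pow_le_one₀ (norm_nonneg _) z.norm_lt_one.le)

end BlochSpace

section ComplexAnalysis

open Metric Nat

theorem norm_sub_taylor_le {g : ℂ → ℂ} {c z : ℂ} {ρ s C : ℝ} (hg : DiffContOnCl ℂ g (ball c s))
    (hC : ∀ w ∈ sphere c s, ‖g w‖ ≤ C) (hz : ‖z - c‖ ≤ ρ) (hρs : ρ < s) (N : ℕ) :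
    ‖g z - ∑ n ∈ Finset.range N, (n ! : ℂ)⁻¹ • (z - c) ^ n • iteratedDeriv n g c‖ ≤
      C * (ρ / s) ^ N * (1 - ρ / s)⁻¹ := by
  have hρ0 : 0 ≤ ρ := (norm_nonneg _).trans hz
  have hs0 : 0 < s := hρ0.trans_lt hρs
  have hseries := Complex.hasSum_taylorSeries_on_ball hg.differentiableOn
    (mem_ball_iff_norm.2 (hz.trans_lt hρs))
  have hgeom := (hasSum_geometric_of_lt_one (div_nonneg hρ0 hs0.le)
    ((div_lt_one hs0).2 hρs)).mul_left (C * (ρ / s) ^ N)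
  refine ((hasSum_nat_add_iff' N).2 hseries).norm_le_of_bounded hgeom fun n => ?_
  have hcauchy :=
    Complex.norm_iteratedDeriv_le_of_forall_mem_sphere_norm_le (n + N) hs0 hg hC
  rw [norm_smul, norm_smul, norm_inv, norm_pow, Complex.norm_natCast]
  calc ((n + N)! : ℝ)⁻¹ * (‖z - c‖ ^ (n + N) * ‖iteratedDeriv (n + N) g c‖)
      ≤ ((n + N)! : ℝ)⁻¹ * (ρ ^ (n + N) * ((n + N)! * C / s ^ (n + N))) := by gcongr
    _ = C * (ρ / s) ^ N * (ρ / s) ^ n := by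
      rw [mul_assoc C, ← pow_add, add_comm N n, div_pow]
      have := Nat.factorial_ne_zero (n + N)
      field_simp

theorem norm_image_sub_le_of_norm_le_closedBall {g : ℂ → ℂ} {c v w : ℂ} {ρ s C : ℝ}
    (hg : DiffContOnCl ℂ g (ball c s)) (hC : ∀ z ∈ closedBall c s, ‖g z‖ ≤ C) (hρs : ρ < s)
    (hv : v ∈ closedBall c ρ) (hw : w ∈ closedBall c ρ) :
    ‖g w - g v‖ ≤ C / (s - ρ) * ‖w - v‖ := by
  have hderiv (z : ℂ) (hz : z ∈ closedBall c ρ) : ‖deriv g z‖ ≤ C / (s - ρ) := by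
    have hzs : s - ρ + dist z c ≤ s := by linarith [mem_closedBall.1 hz]
    exact Complex.norm_deriv_le_of_forall_mem_sphere_norm_le (sub_pos.2 hρs)
      (hg.mono (ball_subset_ball' hzs)) fun y hy =>
        hC y (closedBall_subset_closedBall' hzs (sphere_subset_closedBall hy))
  exact (convex_closedBall c ρ).norm_image_sub_le_of_norm_deriv_le
    (fun z hz => hg.differentiableAt isOpen_ball (closedBall_subset_ball hρs hz)) hderiv hv hw

theorem norm_sub_mul_dilate_le {g : ℂ → ℂ} {w : ℂ} {r ρ s C : ℝ}
    (hg : DiffContOnCl ℂ g (ball 0 s)) (hC : ∀ z ∈ closedBall 0 s, ‖g z‖ ≤ C)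
    (hw : ‖w‖ ≤ ρ) (hρs : ρ < s) (hr0 : 0 ≤ r) (hr1 : r ≤ 1) :
    ‖g w - r * g (r * w)‖ ≤ (1 - r) * (C + C / (s - ρ) * ρ) := by
  have hnorm : ‖(r : ℂ)‖ = r := by rw [Complex.norm_real, Real.norm_of_nonneg hr0]
  have hnorm' : ‖(1 - r : ℂ)‖ = 1 - r := by
    exact_mod_cast Real.norm_of_nonneg (sub_nonneg.2 hr1)
  have hwρ : w ∈ closedBall 0 ρ := mem_closedBall_zero_iff.2 hw
  have hrw : (r * w : ℂ) ∈ closedBall 0 ρ := by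
    rw [mem_closedBall_zero_iff, norm_mul, hnorm]
    exact (mul_le_of_le_one_left (norm_nonneg w) hr1).trans hw
  have hCw : ‖g w‖ ≤ C := hC w (closedBall_subset_closedBall hρs.le hwρ)
  have hC0 : 0 ≤ C := (norm_nonneg _).trans hCw
  have hlipschitz : ‖g w - g (r * w)‖ ≤ C / (s - ρ) * ((1 - r) * ρ) := by
    refine (norm_image_sub_le_of_norm_le_closedBall hg hC hρs hrw hwρ).trans ?_
    rw [← one_sub_mul, norm_mul, hnorm']
    gcongr
  calc ‖g w - r * g (r * w)‖ = ‖(1 - r) * g w + r * (g w - g (r * w))‖ := by ring_nf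
    _ ≤ (1 - r) * ‖g w‖ + r * ‖g w - g (r * w)‖ := by
      simpa only [norm_mul, hnorm, hnorm'] using
        norm_add_le ((1 - r) * g w) (r * (g w - g (r * w)))
    _ ≤ (1 - r) * C + 1 * (C / (s - ρ) * ((1 - r) * ρ)) := by gcongr
    _ = (1 - r) * (C + C / (s - ρ) * ρ) := by ring

end ComplexAnalysis

theorem DiscHolomorphic.diffContOnCl_deriv {f : 𝔻 → ℂ} (hf : DiscHolomorphic f) {s : ℝ}
    (hs : s < 1) : DiffContOnCl ℂ (deriv (discExt f)) (Metric.ball 0 s) :=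
  (DifferentiableOn.deriv hf Metric.isOpen_ball).diffContOnCl_ball
    (Metric.closedBall_subset_ball hs)

theorem DiscHolomorphic.contDiffAt_zero {f : 𝔻 → ℂ} (hf : DiscHolomorphic f) (n : ℕ) :
    ContDiffAt ℂ n (discExt f) 0 :=
  (DifferentiableOn.analyticAt hf (Metric.ball_mem_nhds 0 one_pos)).contDiffAt

namespace BlochSpace

variable {ν : DiscWeight}

/-- The `n`-th Taylor coefficient of the derivative, as a bounded functional. -/
noncomputable def derivCoeff (ν : DiscWeight) (n : ℕ) : BlochSpace ν →L[ℂ] ℂ :=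
  LinearMap.mkContinuousOfExistsBound
    { toFun := fun f => (n.factorial : ℂ)⁻¹ * iteratedDeriv (n + 1) (discExt f.toFun) 0
      map_add' := fun f g => by
        rw [← mul_add, ← iteratedDeriv_add (f.isBloch.1.contDiffAt_zero _)
          (g.isBloch.1.contDiffAt_zero _), ← discExt_add]
        rfl
      map_smul' := fun c f => by
        rw [RingHom.id_apply, smul_eq_mul, mul_left_comm, ← smul_eq_mul c,
          ← iteratedDeriv_const_smul (f.isBloch.1.contDiffAt_zero _), ← discExt_smul]
        rfl } <| by
    obtain ⟨C, hbound⟩ := exists_norm_deriv_discExt_le ν (s := 1 / 2) (by norm_num)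
    refine ⟨C / (1 / 2) ^ n, fun f => ?_⟩
    have hcauchy := Complex.norm_iteratedDeriv_le_of_forall_mem_sphere_norm_le n (c := 0)
      one_half_pos (f.isBloch.1.diffContOnCl_deriv one_half_lt_one)
      fun z hz => hbound f z (mem_sphere_zero_iff_norm.1 hz).le
    rw [← iteratedDeriv_succ'] at hcauchy
    calc _ = (n.factorial : ℝ)⁻¹ * ‖iteratedDeriv (n + 1) (discExt f.toFun) 0‖ := by
          simp
      _ ≤ (n.factorial : ℝ)⁻¹ * (n.factorial * (C * ‖f‖) / (1 / 2) ^ n) := by gcongr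
      _ = C / (1 / 2) ^ n * ‖f‖ := by field_simp

theorem derivCoeff_apply (n : ℕ) (f : BlochSpace ν) :
    derivCoeff ν n f = (n.factorial : ℂ)⁻¹ * iteratedDeriv n (deriv (discExt f.toFun)) 0 := by
  rw [← iteratedDeriv_succ']
  rfl

/-- The finite rank operator sending `f` to a Taylor polynomial of its dilation `z ↦ f (r z)`,
without the constant term. -/
noncomputable def taylorDilate (ν : DiscWeight) (r : ℂ) (N : ℕ) : BlochSpace ν →L[ℂ] BlochSpace ν :=
  ∑ n ∈ Finset.range N, (derivCoeff ν n).smulRight ((r ^ (n + 1) / (n + 1)) • monomial ν (n + 1))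

theorem isCompactOperator_taylorDilate (r : ℂ) (N : ℕ) :
    IsCompactOperator (taylorDilate ν r N) :=
  isCompactOperator_sum _ fun _ _ => isCompactOperator_smulRight _ _

theorem discDeriv_taylorDilate (r : ℂ) (N : ℕ) (f : BlochSpace ν) (z : 𝔻) :
    discDeriv (taylorDilate ν r N f).toFun z =
      r * ∑ n ∈ Finset.range N, (n.factorial : ℂ)⁻¹ • (r * z - 0) ^ n •
        iteratedDeriv n (deriv (discExt f.toFun)) 0 := by
  have hmonomial (n : ℕ) : derivAt ν z (monomial ν (n + 1)) = ((n + 1 : ℕ) : ℂ) * (z : ℂ) ^ n :=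
    discDeriv_pow (n + 1) z
  rw [← derivAt_apply, taylorDilate, sum_apply, map_sum, Finset.mul_sum]
  refine Finset.sum_congr rfl fun n _ => ?_
  have hn : (n : ℂ) + 1 ≠ 0 := n.cast_add_one_ne_zero
  rw [ContinuousLinearMap.smulRight_apply, map_smul, map_smul, hmonomial, derivCoeff_apply]
  simp only [smul_eq_mul, sub_zero, Nat.cast_succ, mul_pow, pow_succ]
  field_simp

theorem exists_dilate_close (ν : DiscWeight) {s ε : ℝ} (hs : s < 1) (hε : 0 < ε) :
    ∃ r ∈ Set.Ioo (0 : ℝ) 1, ∀ (f : BlochSpace ν) (z : 𝔻), ‖(z : ℂ)‖ ≤ s →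
      ‖discDeriv f.toFun z - r * deriv (discExt f.toFun) (r * z)‖ ≤ ε * ‖f‖ := by
  obtain ⟨s', hss', hs'⟩ := exists_between hs
  obtain ⟨C, hbound⟩ := exists_norm_deriv_discExt_le ν hs'
  set D := C + C / (s' - s) * s
  have hr : ∀ᶠ r in nhdsWithin (1 : ℝ) (Set.Iio 1), (1 - r) * D < ε := by
    have : Tendsto (fun r : ℝ => (1 - r) * D) (nhds 1) (nhds ((1 - 1) * D)) :=
      Continuous.tendsto (by fun_prop) 1
    exact (this.mono_left nhdsWithin_le_nhds).eventually_lt_const (by simpa using hε)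
  obtain ⟨r, hrD, hr⟩ := (hr.and (Ioo_mem_nhdsLT one_pos)).exists
  refine ⟨r, hr, fun f z hz => ?_⟩
  refine (norm_sub_mul_dilate_le (f.isBloch.1.diffContOnCl_deriv hs')
    (fun w hw => hbound f w (mem_closedBall_zero_iff.1 hw)) hz hss' hr.1.le hr.2.le).trans ?_
  calc (1 - r) * (C * ‖f‖ + C * ‖f‖ / (s' - s) * s) = (1 - r) * D * ‖f‖ := by ring
    _ ≤ ε * ‖f‖ := by gcongr

theorem exists_taylorDilate_close (ν : DiscWeight) {r ε : ℝ} (hr0 : 0 ≤ r) (hr : r < 1)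
    (hε : 0 < ε) :
    ∃ N : ℕ, ∀ (f : BlochSpace ν) (z : 𝔻),
      ‖r * deriv (discExt f.toFun) (r * z) - discDeriv (taylorDilate ν r N f).toFun z‖ ≤
        ε * ‖f‖ := by
  obtain ⟨s, hrs, hs⟩ := exists_between hr
  obtain ⟨C, hbound⟩ := exists_norm_deriv_discExt_le ν hs
  have hs0 : 0 < s := hr0.trans_lt hrs
  have hlim : Tendsto (fun N : ℕ => C * (r / s) ^ N * (1 - r / s)⁻¹) atTop (nhds 0) := by
    simpa using ((tendsto_pow_atTop_nhds_zero_of_lt_one (div_nonneg hr0 hs0.le)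
      ((div_lt_one hs0).2 hrs)).const_mul C).mul_const (1 - r / s)⁻¹
  obtain ⟨N, hN⟩ := (hlim.eventually_lt_const hε).exists
  refine ⟨N, fun f z => ?_⟩
  have hnorm : ‖(r : ℂ)‖ = r := by rw [Complex.norm_real, Real.norm_of_nonneg hr0]
  have hrz : ‖(r * z : ℂ) - 0‖ ≤ r := by
    rw [sub_zero, norm_mul, hnorm]
    exact mul_le_of_le_one_right hr0 z.norm_lt_one.le
  have htaylor := norm_sub_taylor_le (f.isBloch.1.diffContOnCl_deriv hs)
    (fun w hw => hbound f w (mem_sphere_zero_iff_norm.1 hw).le) hrz hrs N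
  rw [discDeriv_taylorDilate, ← mul_sub, norm_mul, hnorm]
  calc _ ≤ C * ‖f‖ * (r / s) ^ N * (1 - r / s)⁻¹ :=
        (mul_le_of_le_one_left (norm_nonneg _) hr.le).trans htaylor
    _ = C * (r / s) ^ N * (1 - r / s)⁻¹ * ‖f‖ := by ring
    _ ≤ ε * ‖f‖ := by gcongr

theorem mul_norm_dilate_le (hν : ν.IsRadiallyDecreasing) {r : ℝ} (hr0 : 0 ≤ r) (hr1 : r ≤ 1)
    (f : BlochSpace ν) (z : 𝔻) : ν z * ‖r * deriv (discExt f.toFun) (r * z)‖ ≤ ‖f‖ := by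
  have hnorm : ‖(r : ℂ)‖ = r := by rw [Complex.norm_real, Real.norm_of_nonneg hr0]
  have hrz : ‖(r * z : ℂ)‖ ≤ ‖(z : ℂ)‖ := by
    rw [norm_mul, hnorm]
    exact mul_le_of_le_one_left (norm_nonneg _) hr1
  let rz : 𝔻 := .mk (r * z) (hrz.trans_lt z.norm_lt_one)
  calc ν z * ‖r * deriv (discExt f.toFun) (r * z)‖ ≤ ν rz * ‖discDeriv f.toFun rz‖ := by
        rw [norm_mul, hnorm]
        exact mul_le_mul (hν hrz) (mul_le_of_le_one_left (norm_nonneg _) hr1) (by positivity)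
          (ν.pos' rz).le
    _ ≤ ‖f‖ := f.mul_norm_discDeriv_le_norm rz

-- `K f` is a Taylor polynomial of the dilation `z ↦ f (r z)` with `r` close to `1`; both `f` and
-- its dilation contribute to the constant `2`.
theorem exists_isCompactOperator_approx (hν : ν.IsRadiallyDecreasing) {s ε : ℝ} (hs : s < 1)
    (hε : 0 < ε) :
    ∃ K : BlochSpace ν →L[ℂ] BlochSpace ν, IsCompactOperator K ∧ ∀ (f : BlochSpace ν) (z : 𝔻),
      (‖(z : ℂ)‖ ≤ s → ‖discDeriv (f - K f).toFun z‖ ≤ ε * ‖f‖) ∧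
        ν z * ‖discDeriv (f - K f).toFun z‖ ≤ (2 + ε) * ‖f‖ := by
  obtain ⟨B, hB0, hB⟩ := ν.exists_pos_bound
  obtain ⟨r, ⟨hr0, hr1⟩, hdilate⟩ := exists_dilate_close ν hs (half_pos hε)
  obtain ⟨N, htaylor⟩ := exists_taylorDilate_close ν hr0.le hr1
    (lt_min (half_pos hε) (div_pos hε hB0))
  refine ⟨taylorDilate ν r N, isCompactOperator_taylorDilate _ _, fun f z => ?_⟩
  have hsub : discDeriv (f - taylorDilate ν r N f).toFun z =
      discDeriv f.toFun z - discDeriv (taylorDilate ν r N f).toFun z :=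
    (derivAt ν z).map_sub f (taylorDilate ν r N f)
  rw [hsub]
  set a := discDeriv f.toFun z
  set b := r * deriv (discExt f.toFun) (r * z)
  set c := discDeriv (taylorDilate ν r N f).toFun z
  have hbc : ‖b - c‖ ≤ min (ε / 2) (ε / B) * ‖f‖ := htaylor f z
  have htriangle : ‖a - c‖ ≤ ‖a - b‖ + ‖b - c‖ := norm_sub_le_norm_sub_add_norm_sub a b c
  refine ⟨fun hz => ?_, ?_⟩
  · have hhalf : min (ε / 2) (ε / B) * ‖f‖ ≤ ε / 2 * ‖f‖ := by gcongr; exact min_le_left _ _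
    linarith [hdilate f z hz]
  · have hb : ν z * ‖b‖ ≤ ‖f‖ := mul_norm_dilate_le hν hr0.le hr1.le f z
    have hνbc : ν z * ‖b - c‖ ≤ ε * ‖f‖ :=
      calc ν z * ‖b - c‖ ≤ B * (ε / B * ‖f‖) := by
            refine mul_le_mul (hB z) (hbc.trans ?_) (norm_nonneg _) hB0.le
            gcongr
            exact min_le_right _ _
        _ = ε * ‖f‖ := by field_simp
    calc ν z * ‖a - c‖ ≤ ν z * (‖a‖ + ‖b‖ + ‖b - c‖) :=
          mul_le_mul_of_nonneg_left (by linarith [norm_sub_le a b]) (ν.pos' z).le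
      _ ≤ (2 + ε) * ‖f‖ := by linarith [f.mul_norm_discDeriv_le_norm z]

end BlochSpace

/-- The quotient `‖φ ^ j‖_μ / ‖z ^ j‖_ν`; for `ν = logWeight` it is `powerRatio μ φ j`. -/
noncomputable def powerQuotient (ν μ : DiscWeight) (φ : 𝔻 → 𝔻) (j : ℕ) : ℝ :=
  blochSeminorm μ (fun z => (φ z : ℂ) ^ j) / blochSeminorm ν (fun z => (z : ℂ) ^ j)

namespace DiscWeight

/-- Up to the factor `κ`, the norm of some monomial `z ^ (n + 1)` of high degree is attained at any
given point close to the unit circle, so that these monomials detect the size of the weight. -/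
def IsNormedByMonomials (ν : DiscWeight) (κ : ℝ) : Prop :=
  ∀ N : ℕ, ∃ s ∈ Set.Ico (0 : ℝ) 1, ∀ w : 𝔻, s < ‖(w : ℂ)‖ → ∃ n ≥ N,
    blochSeminorm ν (fun z => (z : ℂ) ^ (n + 1)) ≤ κ * (ν w * ((n + 1) * ‖(w : ℂ)‖ ^ n))

theorem IsNormedByMonomials.pos {ν : DiscWeight} {κ : ℝ} (hν : ν.IsNormedByMonomials κ) :
    0 < κ := by
  obtain ⟨s, hs, h⟩ := hν 0
  obtain ⟨r, hsr, hr1⟩ := exists_between hs.2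
  have hr0 : 0 < r := hs.1.trans_lt hsr
  have hnorm : ‖(r : ℂ)‖ = r := by rw [Complex.norm_real, Real.norm_of_nonneg hr0.le]
  let w : 𝔻 := .mk r (hnorm.trans_lt hr1)
  obtain ⟨n, -, hn⟩ := h w (hsr.trans_eq hnorm.symm)
  exact pos_of_mul_pos_left ((BlochSpace.blochSeminorm_pow_succ_pos ν n).trans_le hn)
    (mul_nonneg (ν.pos' w).le (by positivity))

end DiscWeight

section CompositionOperator

open BlochSpace

variable {μ ν : DiscWeight} {φ : 𝔻 → 𝔻}

theorem powerQuotient_nonneg (j : ℕ) : 0 ≤ powerQuotient ν μ φ j :=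
  div_nonneg (seminorm_nonneg _) (seminorm_nonneg _)

theorem powerQuotient_succ_le_norm_compOperator
    (hmaps : ∀ f : 𝔻 → ℂ, IsBloch ν f → IsBloch μ (f ∘ φ)) (n : ℕ) :
    powerQuotient ν μ φ (n + 1) ≤ ‖compOperator φ hmaps (unitMonomial ν n)‖ := by
  rw [unitMonomial, map_smul, norm_smul, Complex.norm_real, norm_inv, norm_norm,
    norm_monomial_succ, powerQuotient, div_eq_inv_mul]
  gcongr
  · exact inv_nonneg.2 (seminorm_nonneg _)
  · exact blochSeminorm_le_norm (compOperator φ hmaps (monomial ν (n + 1)))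

theorem isBoundedUnder_powerQuotient (hmaps : ∀ f : 𝔻 → ℂ, IsBloch ν f → IsBloch μ (f ∘ φ))
    (hbdd : ∃ C : ℝ, ∀ f : BlochSpace ν, ‖compOperator φ hmaps f‖ ≤ C * ‖f‖) :
    IsBoundedUnder (· ≤ ·) atTop (powerQuotient ν μ φ) := by
  let T := (compOperator φ hmaps).mkContinuousOfExistsBound hbdd
  refine isBoundedUnder_of_eventually_le (a := ‖T‖) ?_
  filter_upwards [eventually_ge_atTop 1] with j hj
  obtain ⟨n, rfl⟩ := Nat.exists_eq_add_of_le' hj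
  exact (powerQuotient_succ_le_norm_compOperator hmaps n).trans
    (T.unit_le_opNorm _ (norm_unitMonomial_le n))

theorem limsup_powerQuotient_le_essentialNorm (hν : ν.VanishesAtBoundary)
    (hmaps : ∀ f : 𝔻 → ℂ, IsBloch ν f → IsBloch μ (f ∘ φ))
    (hbdd : ∃ C : ℝ, ∀ f : BlochSpace ν, ‖compOperator φ hmaps f‖ ≤ C * ‖f‖) :
    limsup (powerQuotient ν μ φ) atTop ≤
      essentialNorm ((compOperator φ hmaps).mkContinuousOfExistsBound hbdd) := by
  set T := (compOperator φ hmaps).mkContinuousOfExistsBound hbdd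
  calc limsup (powerQuotient ν μ φ) atTop
      = limsup (fun n => powerQuotient ν μ φ (n + 1)) atTop := (limsup_nat_add _ 1).symm
    _ ≤ limsup (fun n => ‖T (unitMonomial ν n)‖) atTop :=
      limsup_le_limsup (.of_forall (powerQuotient_succ_le_norm_compOperator hmaps))
        (isCoboundedUnder_le_of_le atTop fun n => powerQuotient_nonneg (n + 1))
        (isBoundedUnder_of ⟨‖T‖, fun n => T.unit_le_opNorm _ (norm_unitMonomial_le n)⟩)
    _ ≤ essentialNorm T :=
      (almostDisjoint_unitMonomial hν).limsup_norm_apply_le_essentialNorm norm_unitMonomial_le T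

-- Adding a rank one operator to `K` removes the contribution of the value at the origin.
theorem essentialNorm_le_of_blochSeminorm_le {X : Type*} [NormedAddCommGroup X] [NormedSpace ℂ X]
    (T : X →L[ℂ] BlochSpace μ) {K : X →L[ℂ] BlochSpace μ} (hK : IsCompactOperator K) {C : ℝ}
    (hC : 0 ≤ C) (h : ∀ x, blochSeminorm μ (T x - K x).toFun ≤ C * ‖x‖) :
    essentialNorm T ≤ C := by
  let K₀ := ((evalZero μ).comp (T - K)).smulRight (monomial μ 0)
  refine (essentialNorm_le_norm_sub T (K := K + K₀)
    (hK.add (isCompactOperator_smulRight _ _))).trans ?_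
  refine ContinuousLinearMap.opNorm_le_bound _ hC fun x => ?_
  have hx : (T - (K + K₀)) x = T x - K x - evalZero μ (T x - K x) • monomial μ 0 :=
    sub_add_eq_sub_sub ..
  have hone : evalZero μ (monomial μ 0) = 1 := pow_zero _
  have hderiv (z : 𝔻) : derivAt μ z (monomial μ 0) = 0 :=
    (discDeriv_pow 0 z).trans (by rw [Nat.cast_zero, zero_mul])
  rw [hx]
  refine norm_le_of_forall_le ?_ fun z => ?_
  · rw [← evalZero_apply, map_sub, map_smul, hone, smul_eq_mul, mul_one, sub_self]
  · rw [← derivAt_apply, map_sub, map_smul, hderiv, smul_zero, sub_zero, derivAt_apply]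
    exact (le_seminorm _ z).trans (h x)

theorem exists_mul_norm_discDeriv_symbol_le
    (hmaps : ∀ f : 𝔻 → ℂ, IsBloch ν f → IsBloch μ (f ∘ φ)) :
    ∃ M, ∀ z, μ z * ‖discDeriv (fun z => (φ z : ℂ)) z‖ ≤ M := by
  obtain ⟨M, hM⟩ := (hmaps _ (isBloch_pow ν 1)).2
  simp only [Function.comp_def, pow_one] at hM
  exact ⟨M, fun z => hM ⟨z, rfl⟩⟩

theorem essentialNorm_compOperator_le (hν : ν.IsRadiallyDecreasing)
    (hφ : DiscHolomorphic fun z => (φ z : ℂ))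
    (hmaps : ∀ f : 𝔻 → ℂ, IsBloch ν f → IsBloch μ (f ∘ φ))
    (hbdd : ∃ C : ℝ, ∀ f : BlochSpace ν, ‖compOperator φ hmaps f‖ ≤ C * ‖f‖)
    {s A : ℝ} (hs : s < 1) (hA : 0 ≤ A)
    (h : ∀ z, s < ‖(φ z : ℂ)‖ → μ z * ‖discDeriv (fun z => (φ z : ℂ)) z‖ ≤ A * ν (φ z)) :
    essentialNorm ((compOperator φ hmaps).mkContinuousOfExistsBound hbdd) ≤ 2 * A := by
  set T := (compOperator φ hmaps).mkContinuousOfExistsBound hbdd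
  obtain ⟨M, hM⟩ := exists_mul_norm_discDeriv_symbol_le hmaps
  have hM0 : 0 ≤ M := (mul_nonneg (μ.pos' 0).le (norm_nonneg _)).trans (hM 0)
  have hε (ε : ℝ) (hε : 0 < ε) : essentialNorm T ≤ 2 * A + (A + M) * ε := by
    obtain ⟨K, hK, hfK⟩ := exists_isCompactOperator_approx hν hs hε
    refine essentialNorm_le_of_blochSeminorm_le T (K := T.comp K) (hK.clm_comp T)
      (by positivity) fun f => ?_
    refine ciSup_le fun z => ?_
    set g := f - K f
    set d := ‖discDeriv (fun z => (φ z : ℂ)) z‖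
    have hTg : T f - T (K f) = T g := (map_sub T f (K f)).symm
    have hderiv : ‖discDeriv (T g).toFun z‖ = ‖discDeriv g.toFun (φ z)‖ * d :=
      (congrArg norm (discDeriv_comp g.isBloch.1 hφ z)).trans (norm_mul _ _)
    obtain ⟨hsmall, hlarge⟩ := hfK f (φ z)
    change μ z * ‖discDeriv (T f - T (K f)).toFun z‖ ≤ _
    rw [hTg, hderiv]
    rcases lt_or_ge s ‖(φ z : ℂ)‖ with hz | hz
    · calc μ z * (‖discDeriv g.toFun (φ z)‖ * d) = μ z * d * ‖discDeriv g.toFun (φ z)‖ := by ring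
        _ ≤ A * ν (φ z) * ‖discDeriv g.toFun (φ z)‖ :=
          mul_le_mul_of_nonneg_right (h z hz) (norm_nonneg _)
        _ = A * (ν (φ z) * ‖discDeriv g.toFun (φ z)‖) := by ring
        _ ≤ A * ((2 + ε) * ‖f‖) := by gcongr
        _ ≤ (2 * A + (A + M) * ε) * ‖f‖ := by
          linarith [mul_nonneg (mul_nonneg hM0 hε.le) (norm_nonneg f)]
    · calc μ z * (‖discDeriv g.toFun (φ z)‖ * d) = μ z * d * ‖discDeriv g.toFun (φ z)‖ := by ring
        _ ≤ M * (ε * ‖f‖) := mul_le_mul (hM z) (hsmall hz) (norm_nonneg _) hM0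
        _ ≤ (2 * A + (A + M) * ε) * ‖f‖ := by
          linarith [mul_nonneg (mul_nonneg hA hε.le) (norm_nonneg f), mul_nonneg hA (norm_nonneg f)]
  have hlim : Tendsto (fun ε : ℝ => 2 * A + (A + M) * ε) (nhdsWithin 0 (Set.Ioi 0))
      (nhds (2 * A + (A + M) * 0)) :=
    (Continuous.tendsto (by fun_prop) 0).mono_left nhdsWithin_le_nhds
  rw [mul_zero, add_zero] at hlim
  exact ge_of_tendsto hlim (eventually_mem_nhdsWithin.mono hε)

theorem mul_norm_discDeriv_symbol_le_powerQuotient (hφ : DiscHolomorphic fun z => (φ z : ℂ))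
    (hmaps : ∀ f : 𝔻 → ℂ, IsBloch ν f → IsBloch μ (f ∘ φ)) (n : ℕ) (z : 𝔻) :
    μ z * ((n + 1) * ‖(φ z : ℂ)‖ ^ n * ‖discDeriv (fun z => (φ z : ℂ)) z‖) ≤
      powerQuotient ν μ φ (n + 1) * blochSeminorm ν (fun z => (z : ℂ) ^ (n + 1)) := by
  rw [powerQuotient, div_mul_cancel₀ _ (blochSeminorm_pow_succ_pos ν n).ne',
    ← norm_discDeriv_pow_succ, ← norm_mul,
    ← discDeriv_comp (f := fun z => (z : ℂ) ^ (n + 1)) (isBloch_pow ν (n + 1)).1 hφ]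
  exact le_seminorm (compOperator φ hmaps (monomial ν (n + 1))) z

theorem exists_symbol_bound_of_eventually_powerQuotient_le {κ E : ℝ}
    (hν : ν.IsNormedByMonomials κ) (hφ : DiscHolomorphic fun z => (φ z : ℂ))
    (hmaps : ∀ f : 𝔻 → ℂ, IsBloch ν f → IsBloch μ (f ∘ φ))
    (hE : ∀ᶠ j in atTop, powerQuotient ν μ φ j ≤ E) :
    ∃ s ∈ Set.Ico (0 : ℝ) 1, ∀ z, s < ‖(φ z : ℂ)‖ →
      μ z * ‖discDeriv (fun z => (φ z : ℂ)) z‖ ≤ κ * E * ν (φ z) := by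
  obtain ⟨N, hN⟩ := eventually_atTop.1 hE
  obtain ⟨s, hs, hκ⟩ := hν N
  refine ⟨s, hs, fun z hz => ?_⟩
  obtain ⟨n, hn, hnκ⟩ := hκ (φ z) hz
  have hE0 : 0 ≤ E := (powerQuotient_nonneg _).trans (hN N le_rfl)
  have hpow : 0 < (n + 1) * ‖(φ z : ℂ)‖ ^ n := by
    have := hs.1.trans_lt hz
    positivity
  refine le_of_mul_le_mul_right ?_ hpow
  calc μ z * ‖discDeriv (fun z => (φ z : ℂ)) z‖ * ((n + 1) * ‖(φ z : ℂ)‖ ^ n)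
      = μ z * ((n + 1) * ‖(φ z : ℂ)‖ ^ n * ‖discDeriv (fun z => (φ z : ℂ)) z‖) := by ring
    _ ≤ powerQuotient ν μ φ (n + 1) * blochSeminorm ν (fun z => (z : ℂ) ^ (n + 1)) :=
      mul_norm_discDeriv_symbol_le_powerQuotient hφ hmaps n z
    _ ≤ E * (κ * (ν (φ z) * ((n + 1) * ‖(φ z : ℂ)‖ ^ n))) :=
      mul_le_mul (hN _ (by omega)) hnκ (seminorm_nonneg _) hE0
    _ = κ * E * ν (φ z) * ((n + 1) * ‖(φ z : ℂ)‖ ^ n) := by ring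

theorem essentialNorm_compOperator_le_limsup {κ : ℝ} (hν : ν.IsRadiallyDecreasing)
    (hνκ : ν.IsNormedByMonomials κ) (hφ : DiscHolomorphic fun z => (φ z : ℂ))
    (hmaps : ∀ f : 𝔻 → ℂ, IsBloch ν f → IsBloch μ (f ∘ φ))
    (hbdd : ∃ C : ℝ, ∀ f : BlochSpace ν, ‖compOperator φ hmaps f‖ ≤ C * ‖f‖) :
    essentialNorm ((compOperator φ hmaps).mkContinuousOfExistsBound hbdd) ≤
      2 * κ * limsup (powerQuotient ν μ φ) atTop := by
  set E := limsup (powerQuotient ν μ φ) atTop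
  have hE (E' : ℝ) (hE' : E < E') :
      essentialNorm ((compOperator φ hmaps).mkContinuousOfExistsBound hbdd) ≤ 2 * κ * E' := by
    have hev : ∀ᶠ j in atTop, powerQuotient ν μ φ j ≤ E' :=
      (eventually_lt_of_limsup_lt hE' (isBoundedUnder_powerQuotient hmaps hbdd)).mono
        fun _ => le_of_lt
    have hE'0 : 0 ≤ E' := let ⟨j, hj⟩ := hev.exists; (powerQuotient_nonneg j).trans hj
    obtain ⟨s, hs, hsymbol⟩ := exists_symbol_bound_of_eventually_powerQuotient_le hνκ hφ hmaps hev
    rw [mul_assoc]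
    exact essentialNorm_compOperator_le hν hφ hmaps hbdd hs.2 (mul_nonneg hνκ.pos.le hE'0) hsymbol
  have hlim : Tendsto (fun E' => 2 * κ * E') (nhdsWithin E (Set.Ioi E)) (nhds (2 * κ * E)) :=
    (Continuous.tendsto (by fun_prop) E).mono_left nhdsWithin_le_nhds
  exact ge_of_tendsto hlim (eventually_mem_nhdsWithin.mono hE)

end CompositionOperator

section LogWeight

open Real

theorem one_lt_log_three : 1 < log 3 :=
  lt_trans (by norm_num) log_three_gt_d9

theorem one_le_log_three_div {t : ℝ} (h0 : 0 < t) (h1 : t ≤ 1) : 1 ≤ log (3 / t) :=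
  one_lt_log_three.le.trans <| log_le_log (by norm_num) <| le_div_self (by norm_num) h0 h1

theorem monotoneOn_mul_log_three_div :
    MonotoneOn (fun t : ℝ => t * log (3 / t)) (Set.Ioc 0 1) := by
  rintro s ⟨hs, -⟩ t ⟨ht0, ht1⟩ hst
  have hsplit : log (3 / s) = log (3 / t) + log (t / s) := by
    rw [← log_mul (by positivity) (by positivity)]
    congr 1
    field_simp
  have hlog : s * log (t / s) ≤ t - s := by
    have := mul_le_mul_of_nonneg_left (log_le_sub_one_of_pos (div_pos ht0 hs)) hs.le
    rwa [mul_sub, mul_div_cancel₀ _ hs.ne', mul_one] at this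
  calc s * log (3 / s) ≤ s * log (3 / t) + (t - s) * 1 := by rw [hsplit]; linarith
    _ ≤ s * log (3 / t) + (t - s) * log (3 / t) := by
      have := sub_nonneg.2 hst
      gcongr
      exact one_le_log_three_div ht0 ht1
    _ = t * log (3 / t) := by ring

theorem isRadiallyDecreasing_logWeight : logWeight.IsRadiallyDecreasing := fun w z hwz =>
  monotoneOn_mul_log_three_div ⟨sub_pos.2 z.norm_lt_one, sub_le_self _ (norm_nonneg _)⟩
    ⟨sub_pos.2 w.norm_lt_one, sub_le_self _ (norm_nonneg _)⟩ (sub_le_sub_left hwz 1)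

theorem tendsto_mul_log_three_div :
    Tendsto (fun t : ℝ => t * log (3 / t)) (nhdsWithin 0 (Set.Ioi 0)) (nhds 0) := by
  have hcont : Continuous fun t : ℝ => t * log 3 + negMulLog t :=
    (continuous_mul_const _).add continuous_negMulLog
  have hlim := (hcont.tendsto 0).mono_left (nhdsWithin_le_nhds (s := Set.Ioi 0))
  rw [zero_mul, negMulLog_zero, add_zero] at hlim
  refine hlim.congr' (eventually_mem_nhdsWithin.mono fun t ht => ?_)
  dsimp only
  rw [log_div (by norm_num) (ne_of_gt ht), negMulLog]
  ring

theorem vanishesAtBoundary_logWeight : logWeight.VanishesAtBoundary := by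
  intro ε hε
  have hev := (tendsto_mul_log_three_div.eventually_le_const hε).and (Ioo_mem_nhdsGT one_pos)
  obtain ⟨δ, hδε, hδ0, hδ1⟩ := hev.exists
  refine ⟨1 - δ, ⟨by linarith, by linarith⟩, fun z hz => ?_⟩
  refine le_trans (monotoneOn_mul_log_three_div ⟨sub_pos.2 z.norm_lt_one, ?_⟩ ⟨hδ0, hδ1.le⟩ ?_) hδε
  · exact sub_le_self _ (norm_nonneg _)
  · linarith

-- A single term of the binomial expansion of `(t + (1 - t)) ^ (n + 1)`.
theorem succ_mul_one_sub_pow_le_one {t : ℝ} (h0 : 0 ≤ t) (h1 : t ≤ 1) (n : ℕ) :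
    (n + 1) * t * (1 - t) ^ n ≤ 1 := by
  have hterm := Finset.single_le_sum (s := Finset.range (n + 1 + 1)) (a := 1)
    (f := fun m => t ^ m * (1 - t) ^ (n + 1 - m) * ((n + 1).choose m : ℝ))
    (fun i _ => mul_nonneg (mul_nonneg (pow_nonneg h0 _) (pow_nonneg (by linarith) _))
      (Nat.cast_nonneg _)) (by simp)
  rw [← add_pow, add_sub_cancel, one_pow, pow_one, Nat.add_sub_cancel,
    Nat.choose_one_right] at hterm
  push_cast at hterm
  linarith

theorem mul_log_three_div_mul_pow_le {t : ℝ} (h0 : 0 < t) (h1 : t ≤ 1) (n : ℕ) :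
    t * log (3 / t) * ((n + 1) * (1 - t) ^ n) ≤ log (3 * (n + 1)) := by
  set p := (1 - t) ^ n
  set x := (n + 1) * t
  have hx : 0 < x := by positivity
  have hp0 : 0 ≤ p := pow_nonneg (sub_nonneg.2 h1) n
  have hp1 : p ≤ 1 := pow_le_one₀ (sub_nonneg.2 h1) (sub_le_self 1 h0.le)
  have hxp : x * p ≤ 1 := succ_mul_one_sub_pow_le_one h0.le h1 n
  have hsplit : log (3 / t) = log (3 * (n + 1)) + log x⁻¹ := by
    rw [← log_mul (by positivity) (by positivity)]
    congr 1
    simp only [x]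
    field_simp
  have hlogx : x * log x⁻¹ ≤ 1 - x := by
    have := mul_le_mul_of_nonneg_left (log_le_sub_one_of_pos (inv_pos.2 hx)) hx.le
    rwa [mul_sub, mul_inv_cancel₀ hx.ne', mul_one] at this
  have hlog1 : 1 ≤ log (3 * (n + 1)) := by
    refine one_lt_log_three.le.trans (log_le_log (by norm_num) ?_)
    linarith [n.cast_nonneg (α := ℝ)]
  calc t * log (3 / t) * ((n + 1) * p) = x * p * log (3 * (n + 1)) + p * (x * log x⁻¹) := by
        rw [hsplit]; ring
    _ ≤ x * p * log (3 * (n + 1)) + (1 - x * p) := by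
        linarith [mul_le_mul_of_nonneg_left hlogx hp0]
    _ ≤ x * p * log (3 * (n + 1)) + (1 - x * p) * log (3 * (n + 1)) := by
        linarith [mul_le_mul_of_nonneg_left hlog1 (sub_nonneg.2 hxp)]
    _ = log (3 * (n + 1)) := by ring

theorem blochSeminorm_logWeight_pow_le (n : ℕ) :
    blochSeminorm logWeight (fun z => (z : ℂ) ^ (n + 1)) ≤ log (3 * (n + 1)) := by
  refine ciSup_le fun z => ?_
  have h := mul_log_three_div_mul_pow_le (sub_pos.2 z.norm_lt_one)
    (sub_le_self 1 (norm_nonneg (z : ℂ))) n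
  rw [sub_sub_cancel] at h
  rwa [norm_discDeriv_pow_succ]

theorem log_three_mul_succ_le {t : ℝ} (h0 : 0 < t) {n : ℕ} (hle : (n + 1) * t ≤ 1)
    (hge : 1 / 2 ≤ (n + 1) * t) (hn : n * t ≤ 1 / 2) :
    log (3 * (n + 1)) ≤ 4 * (t * log (3 / t) * ((n + 1) * (1 - t) ^ n)) := by
  have ht1 : t ≤ 1 := by nlinarith [n.cast_nonneg (α := ℝ)]
  have hbernoulli : 1 / 2 ≤ (1 - t) ^ n := by
    have := one_add_mul_le_pow (show (-2 : ℝ) ≤ -t by linarith) n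
    rw [← sub_eq_add_neg] at this
    linarith
  have hlog : log (3 * (n + 1)) ≤ log (3 / t) := by
    refine log_le_log (by positivity) ?_
    rw [le_div_iff₀ h0]
    linarith
  have hlog0 : 0 ≤ log (3 / t) := zero_le_one.trans (one_le_log_three_div h0 ht1)
  calc log (3 * (n + 1)) ≤ 4 * (1 / 2 * (1 / 2)) * log (3 / t) := by linarith
    _ ≤ 4 * ((n + 1) * t * (1 - t) ^ n) * log (3 / t) := by gcongr
    _ = 4 * (t * log (3 / t) * ((n + 1) * (1 - t) ^ n)) := by ring

-- The degree that suits the modulus `1 - t` is about `1 / (2 * t)`.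
theorem isNormedByMonomials_logWeight : logWeight.IsNormedByMonomials 4 := by
  intro N
  refine ⟨1 - 1 / (2 * (N + 1)), ⟨?_, ?_⟩, fun w hw => ?_⟩
  · rw [sub_nonneg, div_le_one (by positivity)]
    linarith [N.cast_nonneg (α := ℝ)]
  · exact sub_lt_self _ (by positivity)
  set t := 1 - ‖(w : ℂ)‖ with ht
  have ht0 : 0 < t := sub_pos.2 w.norm_lt_one
  have htN : (N + 1) * t < 1 / 2 := by
    have : t < 1 / (2 * (N + 1)) := by linarith
    rw [lt_div_iff₀ (by positivity)] at this
    linarith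
  set n := ⌊1 / (2 * t)⌋₊
  have hle : n * t ≤ 1 / 2 := by
    have := Nat.floor_le (show 0 ≤ 1 / (2 * t) by positivity)
    rw [le_div_iff₀ (by positivity)] at this
    linarith
  have hlt : 1 / 2 < (n + 1) * t := by
    have := Nat.lt_floor_add_one (1 / (2 * t))
    rw [div_lt_iff₀ (by positivity)] at this
    linarith
  have hNn : N ≤ n := by
    have : (N + 1 : ℝ) < n + 1 := lt_of_mul_lt_mul_right (htN.trans hlt) ht0.le
    exact_mod_cast (by linarith : (N : ℝ) ≤ n)
  refine ⟨n, hNn, (blochSeminorm_logWeight_pow_le n).trans ?_⟩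
  have htw : ‖(w : ℂ)‖ = 1 - t := by rw [ht, sub_sub_cancel]
  rw [htw]
  refine log_three_mul_succ_le ht0 ?_ hlt.le hle
  nlinarith [N.cast_nonneg (α := ℝ)]

theorem logConst_pos : 0 < logConst :=
  sub_pos.2 ((div_lt_one (one_pos.trans one_lt_log_three)).2 one_lt_log_three)

theorem eight_le_two_mul_logConst_add_div :
    8 ≤ (2 * logConst + 6 * exp (logConst - 1)) / logConst := by
  rw [le_div_iff₀ logConst_pos]
  linarith [add_one_le_exp (logConst - 1)]

end LogWeight

theorem theorem5p1_general {μ ν : DiscWeight} {κ : ℝ} (hdecr : ν.IsRadiallyDecreasing)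
    (hvanish : ν.VanishesAtBoundary) (hκ : ν.IsNormedByMonomials κ) {φ : 𝔻 → 𝔻}
    (hφ : DiscHolomorphic fun z => (φ z : ℂ))
    (hmaps : ∀ f : 𝔻 → ℂ, IsBloch ν f → IsBloch μ (f ∘ φ))
    (hbdd : ∃ C : ℝ, ∀ f : BlochSpace ν, ‖compOperator φ hmaps f‖ ≤ C * ‖f‖) :
    IsBoundedUnder (· ≤ ·) atTop (powerQuotient ν μ φ) ∧
    limsup (powerQuotient ν μ φ) atTop ≤
      essentialNorm ((compOperator φ hmaps).mkContinuousOfExistsBound hbdd) ∧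
    essentialNorm ((compOperator φ hmaps).mkContinuousOfExistsBound hbdd) ≤
      2 * κ * limsup (powerQuotient ν μ φ) atTop :=
  ⟨isBoundedUnder_powerQuotient hmaps hbdd,
    limsup_powerQuotient_le_essentialNorm hvanish hmaps hbdd,
    essentialNorm_compOperator_le_limsup hdecr hκ hφ hmaps hbdd⟩

theorem theorem5p1 (μ : DiscWeight) (φ : 𝔻 → 𝔻)
    (hφ : DiscHolomorphic fun z => (φ z : ℂ))
    (hmaps : ∀ f : 𝔻 → ℂ, IsBloch logWeight f → IsBloch μ (f ∘ φ))
    (hbdd : ∃ C : ℝ, ∀ f : BlochSpace logWeight, ‖compOperator φ hmaps f‖ ≤ C * ‖f‖) :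
    IsBoundedUnder (· ≤ ·) atTop (powerRatio μ φ) ∧
    limsup (powerRatio μ φ) atTop ≤
      essentialNorm ((compOperator φ hmaps).mkContinuousOfExistsBound hbdd) ∧
    essentialNorm ((compOperator φ hmaps).mkContinuousOfExistsBound hbdd) ≤
      (2 * logConst + 6 * Real.exp (logConst - 1)) / logConst *
        limsup (powerRatio μ φ) atTop := by
  obtain ⟨hbounded, hlower, hupper⟩ := theorem5p1_general isRadiallyDecreasing_logWeight
    vanishesAtBoundary_logWeight isNormedByMonomials_logWeight hφ hmaps hbdd
  refine ⟨hbounded, hlower, hupper.trans (mul_le_mul_of_nonneg_right ?_ ?_)⟩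
  · linarith [eight_le_two_mul_logConst_add_div]
  · exact le_limsup_of_frequently_le (.of_forall powerQuotient_nonneg) hbounded
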